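/- Consider oriented singular tangle and link diagrams in the plane: generic immersed oriented curves whose double points are classical crossings (with over/under information) or singular crossings, taken up to planar isotopy. A local move replaces a tangle diagram inside a disk by another one with the same endpoints and leaves the rest of the diagram unchanged; it may be applied in both directions. A set $S$ of moves \emph{generates} a move $m$ if, whenever $m$ is applied to a diagram, the result can also be obtained by a finite sequence of planar isotopies and moves from $S$. Let $\Omega1$, $\Omega2$, $\Omega3$ denote the sets of all oriented classical Reidemeister moves of types one, two and three. Up to rotation there are the following 14 oriented Reidemeister moves that involve a singular crossing. \textbf{Type $\Omega4$ (eight moves).} A third strand passes across a singular crossing of two strands directed upwards, lying over both of them (a, b, c, d) or under both of them (e, f, g, h). In $\Omega4a$, $\Omega4e$ (third strand directed downwards) and $\Omega4b$, $\Omega4f$ (directed upwards) it moves from the left of the singular crossing to its right. In $\Omega4c$, $\Omega4g$ (running from left to right) and $\Omega4d$, $\Omega4h$ (running from right to left) it moves from the two incoming to the two outgoing branches of the singular crossing. \textbf{Type $\Omega5$ (six moves).} Two strands meet successively in a singular crossing and in a classical crossing, and these two crossings, stacked vertically, exchange their order, the classical crossing keeping its unoriented picture. In $\Omega5a$ and $\Omega5d$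 the strands are parallel and the classical crossing is positive and negative, respectively. In $\Omega5b$, $\Omega5c$ (negative classical crossing) and $\Omega5e$, $\Omega5f$ (positive classical crossing) the strands are antiparallel, with lower ends directed up, down (b, e), respectively down, up (c, f), from left to right. \textbf{Theorem.} \begin{enumerate} \item $\Omega1\cup\Omega2\cup\{\Omega4a,\Omega4e,\Omega5a\}$ generates all 14 oriented singular Reidemeister moves. \item $\Omega2\cup\{\Omega4a,\Omega4e\}$ generates all eight $\Omega4$ moves. \item $\Omega1\cup\Omega2\cup\{\Omega4a,\Omega4e,\Omega5d\}$ generates all six $\Omega5$ moves; so, by (1) and (3), either of the two parallel moves $\Omega5a$, $\Omega5d$ alone suffices as the $\Omega5$ generator. \item Consequently, two oriented singular link diagrams are related by a finite sequence of planar isotopies, moves of types $\Omega1,\Omega2,\Omega3$ and the 14 singular moves if and only if they are related by a finite sequence of planar isotopies, moves of types $\Omega1,\Omega2,\Omega3$ and the three moves $\Omega4a,\Omega4e,\Omega5a$. \end{enumerate} -/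

import Mathlib

/-!
Oriented singular tangle and link diagrams in the plane, in generic position with respect to the
height function, i.e. cut by horizontal lines into slices that each hold one elementary piece
(a local minimum, a local maximum, a classical crossing or a singular crossing) between vertical
strands. Slices are listed from the bottom to the top, strands from left to right. Two such sliced
diagrams describe the same plane diagram up to planar isotopy exactly when they are related by
the moves in `planarIsotopy`.
-/

namespace SingularLink

/-- The direction in which an oriented strand runs through a horizontal line. -/
inductive Dir
  | up
  | down
  deriving DecidableEq

/-- The opposite direction. -/
def Dir.rev : Dir → Dir
  | .up => .down
  | .down => .up

/-- At a classical crossing: whether the strand with endpoints bottom left and top right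
passes over or under the other one. -/
inductive Pass
  | above
  | below
  deriving DecidableEq

/-- Exchange above and below. -/
def Pass.swap : Pass → Pass
  | .above => .below
  | .below => .above

/-- The directions of the strands that meet a horizontal line, from left to right. -/
abbrev Word := List Dir

/-- The elementary oriented pieces of a diagram.
* `cup d`: a local minimum, whose left branch has direction `d` and whose right branch has the
  opposite direction;
* `cap d`: a local maximum, likewise;
* `crossing p a b`: a classical crossing of a strand of direction `a` with endpoints bottom left
  and top right and a strand of direction `b` with endpoints bottom right and top left; the first
  one passes over if `p = above`, and under if `p = below`;
* `singular a b`: a singular crossing (transverse double point) of two such strands. -/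
inductive Piece
  | cup (d : Dir)
  | cap (d : Dir)
  | crossing (p : Pass) (a b : Dir)
  | singular (a b : Dir)
  deriving DecidableEq

/-- The lower boundary of a piece. -/
def Piece.bot : Piece → Word
  | .cup _ => []
  | .cap d => [d, d.rev]
  | .crossing _ a b => [a, b]
  | .singular a b => [a, b]

/-- The upper boundary of a piece. -/
def Piece.top : Piece → Word
  | .cup d => [d, d.rev]
  | .cap _ => []
  | .crossing _ a b => [b, a]
  | .singular a b => [b, a]

/-- A slice of a diagram: one piece, with vertical strands to its left and to its right. -/
structure Layer where
  left : Word
  piece : Piece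
  right : Word
  deriving DecidableEq

/-- The lower boundary of a slice. -/
def Layer.bot (s : Layer) : Word := s.left ++ s.piece.bot ++ s.right

/-- The upper boundary of a slice. -/
def Layer.top (s : Layer) : Word := s.left ++ s.piece.top ++ s.right

/-- Add vertical strands `l` on the left and `r` on the right of a slice. -/
def Layer.whisker (l r : Word) (s : Layer) : Layer := ⟨l ++ s.left, s.piece, s.right ++ r⟩

/-- The slices in the list fit together to a diagram with lower boundary `u` and upper
boundary `v`. -/
def IsDiagram : Word → List Layer → Word → Prop
  | u, [], v => u = v
  | u, s :: L, v => u = s.bot ∧ IsDiagram s.top L v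

instance decidableIsDiagram : ∀ (u : Word) (L : List Layer) (v : Word), Decidable (IsDiagram u L v)
  | u, [], v => inferInstanceAs (Decidable (u = v))
  | u, s :: L, v =>
    haveI := decidableIsDiagram s.top L v
    inferInstanceAs (Decidable (u = s.bot ∧ IsDiagram s.top L v))

/-- Oriented singular tangle diagrams with lower boundary `u` and upper boundary `v`. -/
structure Diagram (u v : Word) where
  layers : List Layer
  isDiagram : IsDiagram u layers v

/-- Oriented singular link diagrams: diagrams without endpoints. -/
abbrev LinkDiagram := Diagram [] []

/-- A local move: the tangle diagram `lhs` may be replaced by `rhs`, and conversely. -/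
structure LocalMove where
  lhs : List Layer
  rhs : List Layer

/-- Both sides of the move are tangle diagrams, with the same endpoints. -/
def LocalMove.WellFormed (m : LocalMove) : Prop :=
  ∃ u v, IsDiagram u m.lhs v ∧ IsDiagram u m.rhs v

/-- `D'` arises from `D` by one replacement of the left hand side of a move from `S` that occurs as
a part of `D` by the right hand side, the rest of the diagram being left unchanged. -/
def Step (S : Set LocalMove) {u v : Word} (D D' : Diagram u v) : Prop :=
  ∃ m ∈ S, ∃ (P Q : List Layer) (l r : Word),
    D.layers = P ++ m.lhs.map (Layer.whisker l r) ++ Q ∧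
    D'.layers = P ++ m.rhs.map (Layer.whisker l r) ++ Q

/-- The moves that realize planar isotopy. -/
inductive IsPlanarIsotopy : LocalMove → Prop
  /-- Two pieces side by side, with vertical strands `w` between them, exchange their heights. -/
  | interchange (e f : Piece) (w : Word) : IsPlanarIsotopy
      ⟨[⟨[], e, w ++ f.bot⟩, ⟨e.top ++ w, f, []⟩], [⟨e.bot ++ w, f, []⟩, ⟨[], e, w ++ f.top⟩]⟩
  /-- A zigzag in a strand is pulled straight. -/
  | zigzagRight (d : Dir) : IsPlanarIsotopy ⟨[⟨[d], .cup d.rev, []⟩, ⟨[], .cap d, [d]⟩], []⟩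
  /-- The mirror image zigzag is pulled straight. -/
  | zigzagLeft (d : Dir) : IsPlanarIsotopy ⟨[⟨[], .cup d, [d]⟩, ⟨[d], .cap d.rev, []⟩], []⟩
  /-- A classical crossing is turned clockwise by a right angle. -/
  | rotateCrossing (p : Pass) (a b : Dir) : IsPlanarIsotopy
      ⟨[⟨[], .cup a.rev, [b, a.rev]⟩, ⟨[a.rev], .crossing p a b, [a.rev]⟩,
        ⟨[a.rev, b], .cap a, []⟩],
       [⟨[], .crossing p.swap b a.rev, []⟩]⟩
  /-- A singular crossing is turned clockwise by a right angle. -/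
  | rotateSingular (a b : Dir) : IsPlanarIsotopy
      ⟨[⟨[], .cup a.rev, [b, a.rev]⟩, ⟨[a.rev], .singular a b, [a.rev]⟩,
        ⟨[a.rev, b], .cap a, []⟩],
       [⟨[], .singular b a.rev, []⟩]⟩

/-- The moves that realize planar isotopy, as a set. -/
def planarIsotopy : Set LocalMove := {m | IsPlanarIsotopy m}

/-- `D` can be transformed into `D'` by a finite sequence of planar isotopies and of moves from `S`,
applied in either direction anywhere in the diagram. -/
def Equivalent (S : Set LocalMove) {u v : Word} : Diagram u v → Diagram u v → Prop :=
  Relation.EqvGen (Step (planarIsotopy ∪ S))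

/-- The moves in `S` generate the move `m`: wherever `m` is applied in a diagram, the result can
also be obtained by a finite sequence of planar isotopies and of moves from `S`. -/
def Generates (S : Set LocalMove) (m : LocalMove) : Prop :=
  ∀ (u v : Word) (D D' : Diagram u v), Step {m} D D' → Equivalent S D D'

open Dir Pass Piece

/-- The classical moves of type one (removal of a kink), for an upward strand: the kink lies to the
right or to the left of the strand, and its crossing is positive (`above`) or negative (`below`).
All other positions of the four oriented moves are obtained by rotation. -/
inductive IsOmega1 : LocalMove → Prop
  | right (p : Pass) : IsOmega1
      ⟨[⟨[up], cup up, []⟩, ⟨[], crossing p up up, [down]⟩, ⟨[up], cap up, []⟩], []⟩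
  | left (p : Pass) : IsOmega1
      ⟨[⟨[], cup down, [up]⟩, ⟨[down], crossing p up up, []⟩, ⟨[], cap down, [up]⟩], []⟩

/-- The classical oriented moves of type one. -/
def omega1 : Set LocalMove := {m | IsOmega1 m}

/-- The classical moves of type two, for two vertical strands of arbitrary directions; up to
rotation these are two moves with parallel strands and two moves with antiparallel strands. -/
inductive IsOmega2 : LocalMove → Prop
  | mk (p : Pass) (a b : Dir) : IsOmega2
      ⟨[⟨[], crossing p a b, []⟩, ⟨[], crossing p.swap b a, []⟩], []⟩

/-- The classical oriented moves of type two. -/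
def omega2 : Set LocalMove := {m | IsOmega2 m}

/-- The classical moves of type three, for three strands `a`, `b`, `c` (from left to right at the
bottom) of arbitrary directions. Strand `a` passes over or under `b` as told by `p`, over or under
`c` as told by `q`, and `b` passes over or under `c` as told by `r`; the condition says that the
three strands are in three different layers, one above the other. -/
inductive IsOmega3 : LocalMove → Prop
  | mk (p q r : Pass) (h : p = r → q = p) (a b c : Dir) : IsOmega3
      ⟨[⟨[], crossing p a b, [c]⟩, ⟨[b], crossing q a c, []⟩, ⟨[], crossing r b c, [a]⟩],
       [⟨[a], crossing r b c, []⟩, ⟨[], crossing q a c, [b]⟩, ⟨[c], crossing p a b, []⟩]⟩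

/-- The classical oriented moves of type three. -/
def omega3 : Set LocalMove := {m | IsOmega3 m}

/-- A strand of direction `m` moves from the left of a singular crossing of two upward strands to
its right. On either side it crosses an incoming and an outgoing branch of the singular crossing,
passing over them or under them as told by `p`. -/
def sidePass (p : Pass) (m : Dir) : LocalMove :=
  ⟨[⟨[], crossing p.swap up m, [up]⟩, ⟨[m], singular up up, []⟩, ⟨[], crossing p m up, [up]⟩],
   [⟨[up], crossing p m up, []⟩, ⟨[], singular up up, [m]⟩, ⟨[up], crossing p.swap up m, []⟩]⟩

/-- A strand with endpoints bottom left and top right, of direction `m` (so that it runs to the right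
for `up` and to the left for `down`), moves from below a singular crossing of two upward strands,
where it crosses both incoming branches, to above it, where it crosses both outgoing branches,
passing over them or under them as told by `p`. -/
def crossPass (p : Pass) (m : Dir) : LocalMove :=
  ⟨[⟨[], crossing p m up, [up]⟩, ⟨[up], crossing p m up, []⟩, ⟨[], singular up up, [m]⟩],
   [⟨[m], singular up up, []⟩, ⟨[], crossing p m up, [up]⟩, ⟨[up], crossing p m up, []⟩]⟩

/-- Two strands of directions `a`, `b` (at the bottom, from left to right) meet in a singular and in
a classical crossing; the classical crossing moves from above the singular one to below it. -/
def twistPass (p : Pass) (a b : Dir) : LocalMove :=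
  ⟨[⟨[], singular a b, []⟩, ⟨[], crossing p b a, []⟩],
   [⟨[], crossing p a b, []⟩, ⟨[], singular b a, []⟩]⟩

/-- Names of the eight oriented moves in which a strand passes a singular crossing. -/
inductive Name4
  | a | b | c | d | e | f | g | h

/-- Names of the six oriented moves in which a classical crossing passes a singular crossing of the
same two strands. -/
inductive Name5
  | a | b | c | d | e | f

/-- The eight oriented moves of type four: in `a`, `b`, `c`, `d` the moving strand passes over, in
`e`, `f`, `g`, `h` it passes under. It moves from side to side of the singular crossing, antiparallel
(`a`, `e`) or parallel (`b`, `f`) to its two strands, or from the incoming to the outgoing branches,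
running to the right (`c`, `g`) or to the left (`d`, `h`). -/
def omega4 : Name4 → LocalMove
  | .a => sidePass above down
  | .b => sidePass above up
  | .c => crossPass above up
  | .d => crossPass above down
  | .e => sidePass below down
  | .f => sidePass below up
  | .g => crossPass below up
  | .h => crossPass below down

/-- The six oriented moves of type five: in `a` and `d` the two strands are parallel and the classical
crossing is positive (`a`) or negative (`d`); in the other four they are antiparallel, and the
classical crossing is negative (`b`, `c`) or positive (`e`, `f`). -/
def omega5 : Name5 → LocalMove
  | .a => twistPass above up up
  | .b => twistPass above up down
  | .c => twistPass above down up
  | .d => twistPass below up up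
  | .e => twistPass below up down
  | .f => twistPass below down up

/-- The fourteen oriented singular Reidemeister moves. -/
def singularMoves : Set LocalMove := Set.range omega4 ∪ Set.range omega5

theorem omega4_wellFormed (i : Name4) : (omega4 i).WellFormed := by
  cases i <;>
    first
      | exact ⟨[up, down, up], [up, down, up], by decide, by decide⟩
      | exact ⟨[up, up, up], [up, up, up], by decide, by decide⟩
      | exact ⟨[down, up, up], [up, up, down], by decide, by decide⟩

theorem omega5_wellFormed (i : Name5) : (omega5 i).WellFormed := by
  cases i <;>
    first
      | exact ⟨[up, up], [up, up], by decide, by decide⟩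
      | exact ⟨[up, down], [up, down], by decide, by decide⟩
      | exact ⟨[down, up], [down, up], by decide, by decide⟩

end SingularLink

open SingularLink

/-! Ω2 makes every classical crossing invertible under stacking, so a move can be treated as an
identity and multiplied by crossings from above and below. Multiplying an Ω4 move by one crossing
below and one above turns "from side to side" into "from incoming to outgoing branches" and back
(`crossPass_of_sidePass`, `sidePass_of_crossPass`). To reverse the moving strand, bend it into an S:
its long middle part runs the other way and passes the singular crossing by the move already known
(`crossPass_rev`). Hence Ω4a (over) and Ω4e (under) give all eight moves, and Ω1 plays no role.

For Ω5, multiplying by the inverse crossing on both sides changes the sign (`twistPass_swap`), so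
Ω5a and Ω5d are interchangeable. For antiparallel strands (`twistPass_antiparallel`), write the
singular crossing as a rotated one with both strands upward. Ω4 carries a downward strand across it,
and the classical crossing becomes a kink, removed by Ω1. What remains is a classical crossing
stacked on the upward singular one and a separate crossing of two downward strands. After one
parallel Ω5 move, the pictures from the two sides differ only by heights.

The statement on links follows by replacing each singular move with its derivation
(`Equivalent.of_generates`). -/

namespace SingularLink

open Dir Pass Piece

-- Boundaries of pieces and of stacked diagrams.

attribute [simp] IsDiagram Layer.bot Layer.top Layer.whisker sidePass crossPass twistPass

@[simp] theorem Piece.bot_cup (d : Dir) : (Piece.cup d).bot = [] := rfl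

@[simp] theorem Piece.top_cup (d : Dir) : (Piece.cup d).top = [d, d.rev] := rfl

@[simp] theorem Piece.bot_cap (d : Dir) : (Piece.cap d).bot = [d, d.rev] := rfl

@[simp] theorem Piece.top_cap (d : Dir) : (Piece.cap d).top = [] := rfl

@[simp] theorem Piece.bot_crossing (p : Pass) (a b : Dir) : (Piece.crossing p a b).bot = [a, b] :=
  rfl

@[simp] theorem Piece.top_crossing (p : Pass) (a b : Dir) : (Piece.crossing p a b).top = [b, a] :=
  rfl

@[simp] theorem Piece.bot_singular (a b : Dir) : (Piece.singular a b).bot = [a, b] := rfl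

@[simp] theorem Piece.top_singular (a b : Dir) : (Piece.singular a b).top = [b, a] := rfl

@[simp] theorem Dir.rev_rev (d : Dir) : d.rev.rev = d := by cases d <;> rfl

@[simp] theorem Dir.rev_up : Dir.up.rev = Dir.down := rfl

@[simp] theorem Dir.rev_down : Dir.down.rev = Dir.up := rfl

@[simp] theorem Pass.swap_swap (p : Pass) : p.swap.swap = p := by cases p <;> rfl

theorem isDiagram_append {u v : Word} {A B : List Layer} :
    IsDiagram u (A ++ B) v ↔ ∃ w, IsDiagram u A w ∧ IsDiagram w B v := by
  induction A generalizing u with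
  | nil => simp
  | cons s A ih => simp only [List.cons_append, IsDiagram, ih]; tauto

theorem IsDiagram.whisker {u v : Word} {A : List Layer} (h : IsDiagram u A v) (l r : Word) :
    IsDiagram (l ++ u ++ r) (A.map (Layer.whisker l r)) (l ++ v ++ r) := by
  induction A generalizing u with
  | nil => simpa using h
  | cons s A ih =>
    obtain ⟨rfl, h⟩ := h
    exact ⟨by simp, by simpa using ih h⟩

theorem IsDiagram.target_unique {u v v' : Word} {A : List Layer} (h : IsDiagram u A v)
    (h' : IsDiagram u A v') : v = v' := by
  induction A generalizing u with
  | nil => exact h.symm.trans h'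
  | cons s A ih => exact ih h.2 h'.2

/-- The empty list is a diagram on every word, so only a first slice can determine the lower
boundary. -/
theorem IsDiagram.source_unique {u u' v v' : Word} {A : List Layer} (hA : A ≠ [])
    (h : IsDiagram u A v) (h' : IsDiagram u' A v') : u = u' := by
  cases A with
  | nil => exact absurd rfl hA
  | cons s A => exact h.1.trans h'.1.symm

/-! ### Equivalence of lists of slices, and rewriting inside a larger diagram. -/

/-- Two lists of slices are equivalent diagrams with lower boundary `u` and upper boundary `v`. -/
def Rel (S : Set LocalMove) (u v : Word) (A B : List Layer) : Prop :=
  ∃ (hA : IsDiagram u A v) (hB : IsDiagram u B v),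
    Equivalent S (⟨A, hA⟩ : Diagram u v) ⟨B, hB⟩

namespace Rel

variable {S : Set LocalMove} {u v : Word} {A B C : List Layer}

theorem symm (h : Rel S u v A B) : Rel S u v B A :=
  let ⟨hA, hB, e⟩ := h
  ⟨hB, hA, .symm _ _ e⟩

theorem trans (h : Rel S u v A B) (h' : Rel S u v B C) : Rel S u v A C :=
  let ⟨hA, _, e⟩ := h
  let ⟨_, hC, e'⟩ := h'
  ⟨hA, hC, .trans _ _ _ e e'⟩

instance : Trans (Rel S u v) (Rel S u v) (Rel S u v) := ⟨trans⟩

theorem of_move {m : LocalMove} (hm : m ∈ planarIsotopy ∪ S) (h : IsDiagram u m.lhs v)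
    (h' : IsDiagram u m.rhs v) : Rel S u v m.lhs m.rhs := by
  have w : Layer.whisker [] [] = id := by funext s; simp
  exact ⟨h, h', .rel _ _ ⟨m, hm, [], [], [], [], by simp [w], by simp [w]⟩⟩

/-- Equivalence is a congruence: a step with context `P'`, `Q'`, `l'`, `r'` in the small diagram is
a step of the large one, with the two contexts nested. -/
theorem whisker_context {a b : Word} (h : Rel S u v A B) (P Q : List Layer) (l r : Word)
    (hP : IsDiagram a P (l ++ u ++ r)) (hQ : IsDiagram (l ++ v ++ r) Q b) :
    Rel S a b (P ++ A.map (Layer.whisker l r) ++ Q) (P ++ B.map (Layer.whisker l r) ++ Q) := by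
  obtain ⟨hA, hB, e⟩ := h
  have close (D : Diagram u v) : IsDiagram a (P ++ D.layers.map (Layer.whisker l r) ++ Q) b :=
    isDiagram_append.2 ⟨_, isDiagram_append.2 ⟨_, hP, D.isDiagram.whisker l r⟩, hQ⟩
  have key (D D' : Diagram u v) (h : Equivalent S D D') :
      Equivalent S (⟨_, close D⟩ : Diagram a b) ⟨_, close D'⟩ := by
    induction h with
    | rel D D' h =>
      obtain ⟨m, hm, P', Q', l', r', h, h'⟩ := h
      refine .rel _ _ ⟨m, hm, P ++ P'.map (Layer.whisker l r), Q'.map (Layer.whisker l r) ++ Q,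
        l ++ l', r' ++ r, ?_, ?_⟩
      · simp [h, Function.comp_def]
      · simp [h', Function.comp_def]
    | refl => exact .refl _
    | symm _ _ _ ih => exact .symm _ _ ih
    | trans _ _ _ _ _ ih ih' => exact .trans _ _ _ ih ih'
  exact ⟨close ⟨A, hA⟩, close ⟨B, hB⟩, key _ _ e⟩

/-- Replace the part of a diagram that starts at slice `i` and has vertical strands `l` to its left
and `r` to its right. -/
theorem rewriteAt {a b : Word} {L L' : List Layer} (h : Rel S u v A B) (i : ℕ) (l r : Word)
    -- For concrete slices the default `simp` proofs check the splicing and the boundaries, so a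
    -- rewrite only has to name its position.
    (hL : L.take i ++ A.map (Layer.whisker l r) ++ L.drop (i + A.length) = L := by simp)
    (hL' : L.take i ++ B.map (Layer.whisker l r) ++ L.drop (i + A.length) = L' := by simp)
    (hP : IsDiagram a (L.take i) (l ++ u ++ r) := by simp)
    (hQ : IsDiagram (l ++ v ++ r) (L.drop (i + A.length)) b := by simp) : Rel S a b L L' := by
  have := h.whisker_context (L.take i) (L.drop (i + A.length)) l r hP hQ
  rwa [hL, hL'] at this

/-- One local derivation suffices. As `m.lhs` is nonempty, its slices determine the boundary words
wherever it occurs, and these agree with the whiskered `u` and `v`. -/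
theorem generates {m : LocalMove} (h : Rel S u v m.lhs m.rhs) (hm : m.lhs ≠ []) :
    Generates S m := by
  rintro a b ⟨D, hD⟩ ⟨D', hD'⟩ ⟨m', rfl, P, Q, l, r, rfl, rfl⟩
  obtain ⟨y, hD, hQ⟩ := isDiagram_append.1 hD
  obtain ⟨x, hP, hM⟩ := isDiagram_append.1 hD
  have hw := h.1.whisker l r
  obtain rfl := hM.source_unique (by simpa using hm) hw
  obtain rfl := hM.target_unique hw
  exact (h.whisker_context P Q l r hP hQ).2.2

/-! ### Planar isotopies and rotation of crossings. -/

theorem interchange (e f : Piece) (w : Word) :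
    Rel S (e.bot ++ w ++ f.bot) (e.top ++ w ++ f.top)
      [⟨[], e, w ++ f.bot⟩, ⟨e.top ++ w, f, []⟩] [⟨e.bot ++ w, f, []⟩, ⟨[], e, w ++ f.top⟩] :=
  of_move (.inl (.interchange e f w)) (by simp) (by simp)

theorem zigzagRight (d : Dir) :
    Rel S [d] [d] [⟨[d], .cup d.rev, []⟩, ⟨[], .cap d, [d]⟩] [] :=
  of_move (.inl (.zigzagRight d)) (by simp) (by simp)

theorem zigzagLeft (d : Dir) :
    Rel S [d] [d] [⟨[], .cup d, [d]⟩, ⟨[d], .cap d.rev, []⟩] [] :=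
  of_move (.inl (.zigzagLeft d)) (by simp) (by simp)

theorem rotateCrossing (p : Pass) (a b : Dir) :
    Rel S [b, a.rev] [a.rev, b]
      [⟨[], .cup a.rev, [b, a.rev]⟩, ⟨[a.rev], .crossing p a b, [a.rev]⟩, ⟨[a.rev, b], .cap a, []⟩]
      [⟨[], .crossing p.swap b a.rev, []⟩] :=
  of_move (.inl (.rotateCrossing p a b)) (by simp) (by simp)

theorem rotateSingular (a b : Dir) :
    Rel S [b, a.rev] [a.rev, b]
      [⟨[], .cup a.rev, [b, a.rev]⟩, ⟨[a.rev], .singular a b, [a.rev]⟩, ⟨[a.rev, b], .cap a, []⟩]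
      [⟨[], .singular b a.rev, []⟩] :=
  of_move (.inl (.rotateSingular a b)) (by simp) (by simp)

/-- Turning a piece `Y` counterclockwise gives back the piece `X` if `Y` is `X` turned clockwise. -/
theorem rotate_counterclockwise {X Y : Piece} {a b : Dir} (hX : X.bot = [a, b])
    (hX' : X.top = [b, a])
    (h : Rel S [b, a.rev] [a.rev, b]
      [⟨[], .cup a.rev, [b, a.rev]⟩, ⟨[a.rev], X, [a.rev]⟩, ⟨[a.rev, b], .cap a, []⟩]
      [⟨[], Y, []⟩]) :
    Rel S [a, b] [b, a]
      [⟨[a, b], .cup a.rev, []⟩, ⟨[a], Y, [a]⟩, ⟨[], .cap a, [b, a]⟩] [⟨[], X, []⟩] := by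
  calc
    -- Expanding `Y` leaves `X` with two zigzags on the strand `a`, one below and one above. Height
    -- exchanges bring each cup next to its cap.
    Rel S [a, b] [b, a]
      [⟨[a, b], .cup a.rev, []⟩, ⟨[a], Y, [a]⟩, ⟨[], .cap a, [b, a]⟩]
      [⟨[a, b], .cup a.rev, []⟩, ⟨[a], .cup a.rev, [b, a.rev, a]⟩, ⟨[a, a.rev], X, [a.rev, a]⟩,
        ⟨[a, a.rev, b], .cap a, [a]⟩, ⟨[], .cap a, [b, a]⟩] := h.symm.rewriteAt 1 [a] [a]
    Rel S [a, b] [b, a] _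
      [⟨[a], .cup a.rev, [b]⟩, ⟨[a, a.rev, a, b], .cup a.rev, []⟩, ⟨[a, a.rev], X, [a.rev, a]⟩,
        ⟨[a, a.rev, b], .cap a, [a]⟩, ⟨[], .cap a, [b, a]⟩] :=
      (interchange (.cup a.rev) (.cup a.rev) [b]).symm.rewriteAt 0 [a] [] (hQ := by simp [hX, hX'])
    Rel S [a, b] [b, a] _
      [⟨[a], .cup a.rev, [b]⟩, ⟨[a, a.rev], X, []⟩, ⟨[a, a.rev, b, a], .cup a.rev, []⟩,
        ⟨[a, a.rev, b], .cap a, [a]⟩, ⟨[], .cap a, [b, a]⟩] :=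
      (interchange X (.cup a.rev) []).symm.rewriteAt 1 [a, a.rev] [] (by simp [hX])
        (by simp [hX']) (by simp [hX]) (by simp [hX'])
    Rel S [a, b] [b, a] _
      [⟨[a], .cup a.rev, [b]⟩, ⟨[a, a.rev], X, []⟩, ⟨[], .cap a, [b, a]⟩] :=
      (zigzagRight a).rewriteAt 2 [a, a.rev, b] [] (hP := by simp [hX, hX'])
    Rel S [a, b] [b, a] _
      [⟨[a], .cup a.rev, [b]⟩, ⟨[], .cap a, [a, b]⟩, ⟨[], X, []⟩] :=
      (interchange (.cap a) X []).symm.rewriteAt 1 [] [] (by simp [hX'])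
        (by simp [hX]) (by simp [hX]) (by simp [hX'])
    Rel S [a, b] [b, a] _ [⟨[], X, []⟩] :=
      (zigzagRight a).rewriteAt 0 [] [b] (hQ := by simp [hX, hX'])

theorem rotateCrossing_counterclockwise (p : Pass) (a b : Dir) :
    Rel S [a, b] [b, a]
      [⟨[a, b], .cup a.rev, []⟩, ⟨[a], .crossing p.swap b a.rev, [a]⟩, ⟨[], .cap a, [b, a]⟩]
      [⟨[], .crossing p a b, []⟩] :=
  rotate_counterclockwise rfl rfl (rotateCrossing p a b)

theorem rotateSingular_counterclockwise (a b : Dir) :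
    Rel S [a, b] [b, a]
      [⟨[a, b], .cup a.rev, []⟩, ⟨[a], .singular b a.rev, [a]⟩, ⟨[], .cap a, [b, a]⟩]
      [⟨[], .singular a b, []⟩] :=
  rotate_counterclockwise rfl rfl (rotateSingular a b)

/-! ### The Ω4 moves. -/

theorem cancel (h2 : omega2 ⊆ S) (p : Pass) (a b : Dir) :
    Rel S [a, b] [a, b] [⟨[], .crossing p a b, []⟩, ⟨[], .crossing p.swap b a, []⟩] [] :=
  of_move (.inr (h2 (.mk p a b))) (by simp) (by simp)

theorem cancel_swap (h2 : omega2 ⊆ S) (p : Pass) (a b : Dir) :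
    Rel S [a, b] [a, b] [⟨[], .crossing p.swap a b, []⟩, ⟨[], .crossing p b a, []⟩] [] := by
  simpa using cancel h2 p.swap a b

/-- Multiply by `crossing p m up` below on the left and above on the right; each side then matches
after one Ω2 cancellation. -/
theorem crossPass_of_sidePass (h2 : omega2 ⊆ S) {p : Pass} {m : Dir}
    (h : Rel S [up, m, up] [up, m, up] (sidePass p m).lhs (sidePass p m).rhs) :
    Rel S [m, up, up] [up, up, m] (crossPass p m).lhs (crossPass p m).rhs := by
  calc
    Rel S [m, up, up] [up, up, m] (crossPass p m).lhs
      [⟨[], crossing p m up, [up]⟩, ⟨[up], crossing p m up, []⟩, ⟨[], singular up up, [m]⟩,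
        ⟨[up], crossing p.swap up m, []⟩, ⟨[up], crossing p m up, []⟩] :=
      (cancel_swap h2 p up m).symm.rewriteAt 3 [up] []
    Rel S [m, up, up] [up, up, m] _
      [⟨[], crossing p m up, [up]⟩, ⟨[], crossing p.swap up m, [up]⟩, ⟨[m], singular up up, []⟩,
        ⟨[], crossing p m up, [up]⟩, ⟨[up], crossing p m up, []⟩] := h.symm.rewriteAt 1 [] []
    Rel S [m, up, up] [up, up, m] _ (crossPass p m).rhs := (cancel h2 p m up).rewriteAt 0 [] [up]

/-- The same multiplication undone, with the inverse crossings. -/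
theorem sidePass_of_crossPass (h2 : omega2 ⊆ S) {p : Pass} {m : Dir}
    (h : Rel S [m, up, up] [up, up, m] (crossPass p m).lhs (crossPass p m).rhs) :
    Rel S [up, m, up] [up, m, up] (sidePass p m).lhs (sidePass p m).rhs := by
  calc
    Rel S [up, m, up] [up, m, up] (sidePass p m).lhs
      [⟨[], crossing p.swap up m, [up]⟩, ⟨[m], singular up up, []⟩, ⟨[], crossing p m up, [up]⟩,
        ⟨[up], crossing p m up, []⟩, ⟨[up], crossing p.swap up m, []⟩] :=
      (cancel h2 p m up).symm.rewriteAt 3 [up] []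
    Rel S [up, m, up] [up, m, up] _
      [⟨[], crossing p.swap up m, [up]⟩, ⟨[], crossing p m up, [up]⟩, ⟨[up], crossing p m up, []⟩,
        ⟨[], singular up up, [m]⟩, ⟨[up], crossing p.swap up m, []⟩] := h.symm.rewriteAt 1 [] []
    Rel S [up, m, up] [up, m, up] _ (sidePass p m).rhs :=
      (cancel_swap h2 p up m).rewriteAt 0 [] [up]

/-- The move `crossPass`, with the strand moving from the right of two upward strands to their
left. -/
theorem crossPass_inverse (h2 : omega2 ⊆ S) {p : Pass} {m : Dir}
    (h : Rel S [m, up, up] [up, up, m] (crossPass p m).lhs (crossPass p m).rhs) :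
    Rel S [up, up, m] [m, up, up]
      [⟨[up], crossing p.swap up m, []⟩, ⟨[], crossing p.swap up m, [up]⟩, ⟨[m], singular up up, []⟩]
      [⟨[], singular up up, [m]⟩, ⟨[up], crossing p.swap up m, []⟩,
        ⟨[], crossing p.swap up m, [up]⟩] := by
  calc
    Rel S [up, up, m] [m, up, up]
      [⟨[up], crossing p.swap up m, []⟩, ⟨[], crossing p.swap up m, [up]⟩, ⟨[m], singular up up, []⟩]
      [⟨[up], crossing p.swap up m, []⟩, ⟨[], crossing p.swap up m, [up]⟩, ⟨[m], singular up up, []⟩,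
        ⟨[], crossing p m up, [up]⟩, ⟨[], crossing p.swap up m, [up]⟩] :=
      (cancel h2 p m up).symm.rewriteAt 3 [] [up]
    Rel S [up, up, m] [m, up, up] _
      [⟨[up], crossing p.swap up m, []⟩, ⟨[up], crossing p m up, []⟩, ⟨[], singular up up, [m]⟩,
        ⟨[up], crossing p.swap up m, []⟩, ⟨[], crossing p.swap up m, [up]⟩] :=
      (sidePass_of_crossPass h2 h).rewriteAt 1 [] []
    Rel S [up, up, m] [m, up, up] _
      [⟨[], singular up up, [m]⟩, ⟨[up], crossing p.swap up m, []⟩,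
        ⟨[], crossing p.swap up m, [up]⟩] := (cancel_swap h2 p up m).rewriteAt 0 [up] []

/-- A strand of direction `n` that crosses two upward strands from left to right, written in terms
of the crossings of a strand of the opposite direction. -/
theorem bend_two_crossings (p : Pass) (n : Dir) :
    Rel S [n, up, up] [up, up, n]
      [⟨[], crossing p n up, [up]⟩, ⟨[up], crossing p n up, []⟩]
      [⟨[n, up, up], cup n.rev, []⟩, ⟨[n, up], crossing p.swap up n.rev, [n]⟩,
        ⟨[n], crossing p.swap up n.rev, [up, n]⟩, ⟨[], cap n, [up, up, n]⟩] := by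
  have bend := rotateCrossing_counterclockwise (S := S) p n up
  calc
    Rel S [n, up, up] [up, up, n]
      [⟨[], crossing p n up, [up]⟩, ⟨[up], crossing p n up, []⟩]
      [⟨[n, up], cup n.rev, [up]⟩, ⟨[n], crossing p.swap up n.rev, [n, up]⟩,
        ⟨[], cap n, [up, n, up]⟩, ⟨[up], crossing p n up, []⟩] := bend.symm.rewriteAt 0 [] [up]
    Rel S [n, up, up] [up, up, n] _
      [⟨[n, up], cup n.rev, [up]⟩, ⟨[n], crossing p.swap up n.rev, [n, up]⟩,
        ⟨[n, n.rev, up], crossing p n up, []⟩, ⟨[], cap n, [up, up, n]⟩] :=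
      (interchange (cap n) (crossing p n up) [up]).rewriteAt 2 [] []
    Rel S [n, up, up] [up, up, n] _
      [⟨[n, up], cup n.rev, [up]⟩, ⟨[n, up, n.rev], crossing p n up, []⟩,
        ⟨[n], crossing p.swap up n.rev, [up, n]⟩, ⟨[], cap n, [up, up, n]⟩] :=
      (interchange (crossing p.swap up n.rev) (crossing p n up) []).rewriteAt 1 [n] []
    Rel S [n, up, up] [up, up, n] _
      [⟨[n, up], cup n.rev, [up]⟩, ⟨[n, up, n.rev, n, up], cup n.rev, []⟩,
        ⟨[n, up, n.rev, n], crossing p.swap up n.rev, [n]⟩, ⟨[n, up, n.rev], cap n, [up, n]⟩,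
        ⟨[n], crossing p.swap up n.rev, [up, n]⟩, ⟨[], cap n, [up, up, n]⟩] :=
      bend.symm.rewriteAt 1 [n, up, n.rev] []
    Rel S [n, up, up] [up, up, n] _
      [⟨[n, up, up], cup n.rev, []⟩, ⟨[n, up], cup n.rev, [up, n.rev, n]⟩,
        ⟨[n, up, n.rev, n], crossing p.swap up n.rev, [n]⟩, ⟨[n, up, n.rev], cap n, [up, n]⟩,
        ⟨[n], crossing p.swap up n.rev, [up, n]⟩, ⟨[], cap n, [up, up, n]⟩] :=
      (interchange (cup n.rev) (cup n.rev) [up]).rewriteAt 0 [n, up] []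
    Rel S [n, up, up] [up, up, n] _
      [⟨[n, up, up], cup n.rev, []⟩, ⟨[n, up], crossing p.swap up n.rev, [n]⟩,
        ⟨[n, up], cup n.rev, [n.rev, up, n]⟩, ⟨[n, up, n.rev], cap n, [up, n]⟩,
        ⟨[n], crossing p.swap up n.rev, [up, n]⟩, ⟨[], cap n, [up, up, n]⟩] :=
      (interchange (cup n.rev) (crossing p.swap up n.rev) []).rewriteAt 1 [n, up] [n]
    -- The cup of the first bend and the cap of the second form a zigzag; pulling it straight leaves
    -- a single S.
    Rel S [n, up, up] [up, up, n] _
      [⟨[n, up, up], cup n.rev, []⟩, ⟨[n, up], crossing p.swap up n.rev, [n]⟩,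
        ⟨[n], crossing p.swap up n.rev, [up, n]⟩, ⟨[], cap n, [up, up, n]⟩] :=
      (zigzagLeft n.rev).rewriteAt 2 [n, up] [up, n]

/-- A strand that can pass a singular crossing can also do so with the opposite direction. -/
theorem crossPass_rev (h2 : omega2 ⊆ S) {p : Pass} {m : Dir}
    (h : Rel S [m, up, up] [up, up, m] (crossPass p m).lhs (crossPass p m).rhs) :
    Rel S [m.rev, up, up] [up, up, m.rev] (crossPass p m.rev).lhs (crossPass p m.rev).rhs := by
  -- With `m` written as `n.rev`, the strand in the goal has direction `n` and the middle of its S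
  -- has the known direction `m`.
  obtain ⟨n, rfl⟩ : ∃ n : Dir, m = n.rev := ⟨m.rev, by simp⟩
  rw [Dir.rev_rev]
  have bend := bend_two_crossings (S := S) p n
  calc
    Rel S [n, up, up] [up, up, n] (crossPass p n).lhs
      [⟨[n, up, up], cup n.rev, []⟩, ⟨[n, up], crossing p.swap up n.rev, [n]⟩,
        ⟨[n], crossing p.swap up n.rev, [up, n]⟩, ⟨[], cap n, [up, up, n]⟩,
        ⟨[], singular up up, [n]⟩] := bend.rewriteAt 0 [] []
    Rel S [n, up, up] [up, up, n] _
      [⟨[n, up, up], cup n.rev, []⟩, ⟨[n, up], crossing p.swap up n.rev, [n]⟩,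
        ⟨[n], crossing p.swap up n.rev, [up, n]⟩, ⟨[n, n.rev], singular up up, [n]⟩,
        ⟨[], cap n, [up, up, n]⟩] :=
      (interchange (cap n) (singular up up) []).rewriteAt 3 [] [n]
    -- The middle of the S runs from bottom right to top left, hence the inverse form of the known
    -- move.
    Rel S [n, up, up] [up, up, n] _
      [⟨[n, up, up], cup n.rev, []⟩, ⟨[n], singular up up, [n.rev, n]⟩,
        ⟨[n, up], crossing p.swap up n.rev, [n]⟩, ⟨[n], crossing p.swap up n.rev, [up, n]⟩,
        ⟨[], cap n, [up, up, n]⟩] := (crossPass_inverse h2 h).rewriteAt 1 [n] [n]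
    Rel S [n, up, up] [up, up, n] _
      [⟨[n], singular up up, []⟩, ⟨[n, up, up], cup n.rev, []⟩,
        ⟨[n, up], crossing p.swap up n.rev, [n]⟩, ⟨[n], crossing p.swap up n.rev, [up, n]⟩,
        ⟨[], cap n, [up, up, n]⟩] :=
      (interchange (singular up up) (cup n.rev) []).symm.rewriteAt 0 [n] []
    Rel S [n, up, up] [up, up, n] _ (crossPass p n).rhs := bend.symm.rewriteAt 1 [] []

/-! ### Crossings at minima and maxima, and the Ω5 moves. -/

/-- A crossing next to a minimum moves from one branch of the minimum to the other. -/
theorem slide_cup (p : Pass) (e x : Dir) :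
    Rel S [x] [e, x, e.rev] [⟨[], cup e, [x]⟩, ⟨[e], crossing p e.rev x, []⟩]
      [⟨[x], cup e, []⟩, ⟨[], crossing p.swap x e, [e.rev]⟩] := by
  have bend := rotateCrossing_counterclockwise (S := S) p e.rev x
  rw [Dir.rev_rev] at bend
  calc
    Rel S [x] [e, x, e.rev] [⟨[], cup e, [x]⟩, ⟨[e], crossing p e.rev x, []⟩]
      [⟨[], cup e, [x]⟩, ⟨[e, e.rev, x], cup e, []⟩, ⟨[e, e.rev], crossing p.swap x e, [e.rev]⟩,
        ⟨[e], cap e.rev, [x, e.rev]⟩] := bend.symm.rewriteAt 1 [e] []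
    Rel S [x] [e, x, e.rev] _
      [⟨[x], cup e, []⟩, ⟨[], cup e, [x, e, e.rev]⟩, ⟨[e, e.rev], crossing p.swap x e, [e.rev]⟩,
        ⟨[e], cap e.rev, [x, e.rev]⟩] := (interchange (cup e) (cup e) [x]).rewriteAt 0 [] []
    Rel S [x] [e, x, e.rev] _
      [⟨[x], cup e, []⟩, ⟨[], crossing p.swap x e, [e.rev]⟩, ⟨[], cup e, [e, x, e.rev]⟩,
        ⟨[e], cap e.rev, [x, e.rev]⟩] :=
      (interchange (cup e) (crossing p.swap x e) []).rewriteAt 1 [] [e.rev]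
    Rel S [x] [e, x, e.rev] _
      [⟨[x], cup e, []⟩, ⟨[], crossing p.swap x e, [e.rev]⟩] :=
      (zigzagLeft e).rewriteAt 2 [] [x, e.rev]

/-- A crossing next to a maximum moves from one branch of the maximum to the other. -/
theorem slide_cap (p : Pass) (x y : Dir) :
    Rel S [y, x, y.rev] [x] [⟨[y], crossing p x y.rev, []⟩, ⟨[], cap y, [x]⟩]
      [⟨[], crossing p.swap y x, [y.rev]⟩, ⟨[x], cap y, []⟩] := by
  have bend := rotateCrossing (S := S) p.swap y x
  rw [Pass.swap_swap] at bend
  calc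
    Rel S [y, x, y.rev] [x] [⟨[y], crossing p x y.rev, []⟩, ⟨[], cap y, [x]⟩]
      [⟨[y], cup y.rev, [x, y.rev]⟩, ⟨[y, y.rev], crossing p.swap y x, [y.rev]⟩,
        ⟨[y, y.rev, x], cap y, []⟩, ⟨[], cap y, [x]⟩] := bend.symm.rewriteAt 0 [y] []
    Rel S [y, x, y.rev] [x] _
      [⟨[y], cup y.rev, [x, y.rev]⟩, ⟨[y, y.rev], crossing p.swap y x, [y.rev]⟩,
        ⟨[], cap y, [x, y, y.rev]⟩, ⟨[x], cap y, []⟩] :=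
      (interchange (cap y) (cap y) [x]).symm.rewriteAt 2 [] []
    Rel S [y, x, y.rev] [x] _
      [⟨[y], cup y.rev, [x, y.rev]⟩, ⟨[], cap y, [y, x, y.rev]⟩,
        ⟨[], crossing p.swap y x, [y.rev]⟩, ⟨[x], cap y, []⟩] :=
      (interchange (cap y) (crossing p.swap y x) []).symm.rewriteAt 1 [] [y.rev]
    Rel S [y, x, y.rev] [x] _ [⟨[], crossing p.swap y x, [y.rev]⟩, ⟨[x], cap y, []⟩] :=
      (zigzagRight y).rewriteAt 0 [] [x, y.rev]

theorem remove_kink (h1 : omega1 ⊆ S) (p : Pass) :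
    Rel S [up] [up] [⟨[], cup down, [up]⟩, ⟨[down], crossing p up up, []⟩, ⟨[], cap down, [up]⟩]
      [] :=
  of_move (.inr (h1 (.left p))) (by simp) (by simp)

/-- Rotating the crossing exposes a kink on the upward branch of the other minimum, which Ω1
removes. `untwist_cap` is the same at a maximum. -/
theorem untwist_cup (h1 : omega1 ⊆ S) (p : Pass) :
    Rel S [] [up, down] [⟨[], cup down, []⟩, ⟨[], crossing p down up, []⟩] [⟨[], cup up, []⟩] := by
  calc
    Rel S [] [up, down] [⟨[], cup down, []⟩, ⟨[], crossing p down up, []⟩]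
      [⟨[], cup down, []⟩, ⟨[down, up], cup up, []⟩, ⟨[down], crossing p.swap up up, [down]⟩,
        ⟨[], cap down, [up, down]⟩] :=
      (rotateCrossing_counterclockwise p down up).symm.rewriteAt 1 [] []
    Rel S [] [up, down] _
      [⟨[], cup up, []⟩, ⟨[], cup down, [up, down]⟩, ⟨[down], crossing p.swap up up, [down]⟩,
        ⟨[], cap down, [up, down]⟩] := (interchange (cup down) (cup up) []).rewriteAt 0 [] []
    Rel S [] [up, down] _ [⟨[], cup up, []⟩] := (remove_kink h1 p.swap).rewriteAt 1 [] [down]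

theorem untwist_cap (h1 : omega1 ⊆ S) (p : Pass) :
    Rel S [up, down] [] [⟨[], crossing p up down, []⟩, ⟨[], cap down, []⟩] [⟨[], cap up, []⟩] := by
  have bend := rotateCrossing (S := S) p.swap up up
  rw [Pass.swap_swap] at bend
  calc
    Rel S [up, down] [] [⟨[], crossing p up down, []⟩, ⟨[], cap down, []⟩]
      [⟨[], cup down, [up, down]⟩, ⟨[down], crossing p.swap up up, [down]⟩, ⟨[down, up], cap up, []⟩,
        ⟨[], cap down, []⟩] := bend.symm.rewriteAt 0 [] []
    Rel S [up, down] [] _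
      [⟨[], cup down, [up, down]⟩, ⟨[down], crossing p.swap up up, [down]⟩,
        ⟨[], cap down, [up, down]⟩, ⟨[], cap up, []⟩] :=
      (interchange (cap down) (cap up) []).symm.rewriteAt 2 [] []
    Rel S [up, down] [] _ [⟨[], cap up, []⟩] := (remove_kink h1 p.swap).rewriteAt 0 [] [down]

/-- Multiplying by the inverse of the classical crossing on both sides. -/
theorem twistPass_swap (h2 : omega2 ⊆ S) {p : Pass} {a b : Dir}
    (h : Rel S [a, b] [a, b] (twistPass p a b).lhs (twistPass p a b).rhs) :
    Rel S [b, a] [b, a] (twistPass p.swap b a).lhs (twistPass p.swap b a).rhs := by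
  calc
    Rel S [b, a] [b, a] (twistPass p.swap b a).lhs
      [⟨[], crossing p.swap b a, []⟩, ⟨[], crossing p a b, []⟩, ⟨[], singular b a, []⟩,
        ⟨[], crossing p.swap a b, []⟩] := (cancel_swap h2 p b a).symm.rewriteAt 0 [] []
    Rel S [b, a] [b, a] _
      [⟨[], crossing p.swap b a, []⟩, ⟨[], singular a b, []⟩, ⟨[], crossing p b a, []⟩,
        ⟨[], crossing p.swap a b, []⟩] := h.symm.rewriteAt 1 [] []
    Rel S [b, a] [b, a] _ (twistPass p.swap b a).rhs := (cancel h2 p b a).rewriteAt 2 [] []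

/-- A classical crossing passes a singular crossing of two antiparallel strands. -/
theorem twistPass_antiparallel (h1 : omega1 ⊆ S) (h2 : omega2 ⊆ S) {p : Pass}
    (h : ∀ q, Rel S [down, up, up] [up, up, down] (crossPass q down).lhs (crossPass q down).rhs)
    (h5 : Rel S [up, up] [up, up] (twistPass p.swap up up).lhs (twistPass p.swap up up).rhs) :
    Rel S [up, down] [up, down] (twistPass p up down).lhs (twistPass p up down).rhs := by
  -- In `upper` the downward strand crosses from bottom right to top left, which exchanges the roles
  -- of over and under; this is why `h` is needed for both passes.
  have hp := crossPass_inverse h2 (h p.swap)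
  rw [Pass.swap_swap] at hp
  -- The target picture keeps the two parallel crossings apart from a crossing of the two downward
  -- strands.
  have lower : Rel S [up, down] [up, down] (twistPass p up down).lhs
      [⟨[up], cup up, [down]⟩, ⟨[], singular up up, [down, down]⟩,
        ⟨[], crossing p.swap up up, [down, down]⟩, ⟨[up, up], crossing p down down, []⟩,
        ⟨[up], cap up, [down]⟩] := by
    calc
      Rel S [up, down] [up, down] (twistPass p up down).lhs
        [⟨[], cup down, [up, down]⟩, ⟨[down], singular up up, [down]⟩, ⟨[down, up], cap up, []⟩,
          ⟨[], crossing p down up, []⟩] := (rotateSingular up up).symm.rewriteAt 0 [] []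
      Rel S [up, down] [up, down] _
        [⟨[], cup down, [up, down]⟩, ⟨[down], singular up up, [down]⟩,
          ⟨[], crossing p down up, [up, down]⟩, ⟨[up, down], cap up, []⟩] :=
        (interchange (crossing p down up) (cap up) []).symm.rewriteAt 2 [] []
      -- The inserted pair makes the downward strand cross both outgoing branches, as the Ω4 move
      -- requires.
      Rel S [up, down] [up, down] _
        [⟨[], cup down, [up, down]⟩, ⟨[down], singular up up, [down]⟩,
          ⟨[], crossing p down up, [up, down]⟩, ⟨[up], crossing p down up, [down]⟩,
          ⟨[up], crossing p.swap up down, [down]⟩, ⟨[up, down], cap up, []⟩] :=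
        (cancel h2 p down up).symm.rewriteAt 3 [up] [down]
      Rel S [up, down] [up, down] _
        [⟨[], cup down, [up, down]⟩, ⟨[], crossing p down up, [up, down]⟩,
          ⟨[up], crossing p down up, [down]⟩, ⟨[], singular up up, [down, down]⟩,
          ⟨[up], crossing p.swap up down, [down]⟩, ⟨[up, down], cap up, []⟩] :=
        (h p).symm.rewriteAt 1 [] [down]
      Rel S [up, down] [up, down] _
        [⟨[], cup up, [up, down]⟩, ⟨[up], crossing p down up, [down]⟩,
          ⟨[], singular up up, [down, down]⟩, ⟨[up], crossing p.swap up down, [down]⟩,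
          ⟨[up, down], cap up, []⟩] := (untwist_cup h1 p).rewriteAt 0 [] [up, down]
      Rel S [up, down] [up, down] _
        [⟨[up], cup up, [down]⟩, ⟨[], crossing p.swap up up, [down, down]⟩,
          ⟨[], singular up up, [down, down]⟩, ⟨[up], crossing p.swap up down, [down]⟩,
          ⟨[up, down], cap up, []⟩] := (slide_cup p up up).rewriteAt 0 [] [down]
      -- The only use of the parallel Ω5 move.
      Rel S [up, down] [up, down] _
        [⟨[up], cup up, [down]⟩, ⟨[], singular up up, [down, down]⟩,
          ⟨[], crossing p.swap up up, [down, down]⟩, ⟨[up], crossing p.swap up down, [down]⟩,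
          ⟨[up, down], cap up, []⟩] := h5.symm.rewriteAt 1 [] [down, down]
      Rel S [up, down] [up, down] _
        [⟨[up], cup up, [down]⟩, ⟨[], singular up up, [down, down]⟩,
          ⟨[], crossing p.swap up up, [down, down]⟩, ⟨[up, up], crossing p down down, []⟩,
          ⟨[up], cap up, [down]⟩] := (slide_cap p down up).symm.rewriteAt 3 [up] []
  -- Rotating the other way puts the minimum on the right and the maximum on the left, so here the
  -- kink appears at the maximum.
  have upper : Rel S [up, down] [up, down] (twistPass p up down).rhs
      [⟨[up], cup up, [down]⟩, ⟨[up, up], crossing p down down, []⟩,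
        ⟨[], singular up up, [down, down]⟩, ⟨[], crossing p.swap up up, [down, down]⟩,
        ⟨[up], cap up, [down]⟩] := by
    calc
      Rel S [up, down] [up, down] (twistPass p up down).rhs
        [⟨[], crossing p up down, []⟩, ⟨[down, up], cup up, []⟩, ⟨[down], singular up up, [down]⟩,
          ⟨[], cap down, [up, down]⟩] :=
        (rotateSingular_counterclockwise down up).symm.rewriteAt 1 [] []
      Rel S [up, down] [up, down] _
        [⟨[up, down], cup up, []⟩, ⟨[], crossing p up down, [up, down]⟩,
          ⟨[down], singular up up, [down]⟩, ⟨[], cap down, [up, down]⟩] :=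
        (interchange (crossing p up down) (cup up) []).rewriteAt 0 [] []
      Rel S [up, down] [up, down] _
        [⟨[up, down], cup up, []⟩, ⟨[up], crossing p.swap down up, [down]⟩,
          ⟨[up], crossing p up down, [down]⟩, ⟨[], crossing p up down, [up, down]⟩,
          ⟨[down], singular up up, [down]⟩, ⟨[], cap down, [up, down]⟩] :=
        (cancel_swap h2 p down up).symm.rewriteAt 1 [up] [down]
      Rel S [up, down] [up, down] _
        [⟨[up, down], cup up, []⟩, ⟨[up], crossing p.swap down up, [down]⟩,
          ⟨[], singular up up, [down, down]⟩, ⟨[up], crossing p up down, [down]⟩,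
          ⟨[], crossing p up down, [up, down]⟩, ⟨[], cap down, [up, down]⟩] :=
        hp.rewriteAt 2 [] [down]
      Rel S [up, down] [up, down] _
        [⟨[up, down], cup up, []⟩, ⟨[up], crossing p.swap down up, [down]⟩,
          ⟨[], singular up up, [down, down]⟩, ⟨[up], crossing p up down, [down]⟩,
          ⟨[], cap up, [up, down]⟩] := (untwist_cap h1 p).rewriteAt 4 [] [up, down]
      Rel S [up, down] [up, down] _
        [⟨[up, down], cup up, []⟩, ⟨[up], crossing p.swap down up, [down]⟩,
          ⟨[], singular up up, [down, down]⟩, ⟨[], crossing p.swap up up, [down, down]⟩,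
          ⟨[up], cap up, [down]⟩] := (slide_cap p up up).rewriteAt 3 [] [down]
      Rel S [up, down] [up, down] _
        [⟨[up], cup up, [down]⟩, ⟨[up, up], crossing p down down, []⟩,
          ⟨[], singular up up, [down, down]⟩, ⟨[], crossing p.swap up up, [down, down]⟩,
          ⟨[up], cap up, [down]⟩] :=
        (slide_cup p up down).symm.rewriteAt 0 [up] []
  calc
    Rel S [up, down] [up, down] (twistPass p up down).lhs
      [⟨[up], cup up, [down]⟩, ⟨[], singular up up, [down, down]⟩,
        ⟨[], crossing p.swap up up, [down, down]⟩, ⟨[up, up], crossing p down down, []⟩,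
        ⟨[up], cap up, [down]⟩] := lower
    Rel S [up, down] [up, down] _
      [⟨[up], cup up, [down]⟩, ⟨[], singular up up, [down, down]⟩,
        ⟨[up, up], crossing p down down, []⟩, ⟨[], crossing p.swap up up, [down, down]⟩,
        ⟨[up], cap up, [down]⟩] :=
      (interchange (crossing p.swap up up) (crossing p down down) []).rewriteAt 2 [] []
    Rel S [up, down] [up, down] _
      [⟨[up], cup up, [down]⟩, ⟨[up, up], crossing p down down, []⟩,
        ⟨[], singular up up, [down, down]⟩, ⟨[], crossing p.swap up up, [down, down]⟩,
        ⟨[up], cap up, [down]⟩] :=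
      (interchange (singular up up) (crossing p down down) []).rewriteAt 1 [] []
    Rel S [up, down] [up, down] _ (twistPass p up down).rhs := upper.symm

theorem crossPass_of_mem (h2 : omega2 ⊆ S) (ha : omega4 .a ∈ S) (he : omega4 .e ∈ S) (p : Pass)
    (m : Dir) : Rel S [m, up, up] [up, up, m] (crossPass p m).lhs (crossPass p m).rhs := by
  have hd : Rel S [down, up, up] [up, up, down] (crossPass p down).lhs (crossPass p down).rhs := by
    refine crossPass_of_sidePass h2 (of_move (.inr ?_) (by simp) (by simp))
    cases p
    exacts [ha, he]
  cases m
  exacts [crossPass_rev h2 hd, hd]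

/-- A single move `twistPass` of two parallel strands suffices for all of them. -/
theorem twistPass_of_mem (h1 : omega1 ⊆ S) (h2 : omega2 ⊆ S) (ha : omega4 .a ∈ S)
    (he : omega4 .e ∈ S) {q : Pass} (h5 : twistPass q up up ∈ S) (p : Pass) {a b : Dir}
    (hab : a = up ∨ b = up) :
    Rel S [a, b] [a, b] (twistPass p a b).lhs (twistPass p a b).rhs := by
  have parallel (p : Pass) :
      Rel S [up, up] [up, up] (twistPass p up up).lhs (twistPass p up up).rhs := by
    have hq := of_move (u := [up, up]) (v := [up, up]) (.inr h5) (by simp) (by simp)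
    have hq' := twistPass_swap h2 hq
    cases p <;> cases q
    -- Either `p = q` or `p = q.swap`.
    exacts [hq, hq', hq', hq]
  have antiparallel (p : Pass) :
      Rel S [up, down] [up, down] (twistPass p up down).lhs (twistPass p up down).rhs :=
    twistPass_antiparallel h1 h2 (fun q ↦ crossPass_of_mem h2 ha he q down) (parallel p.swap)
  cases a <;> cases b
  · exact parallel p
  · exact antiparallel p
  · simpa only [Pass.swap_swap] using twistPass_swap h2 (antiparallel p.swap)
  · simp at hab

end Rel

/-! ### From equivalences to generation, and the main theorem. -/

theorem generates_omega4 {S : Set LocalMove} (h2 : omega2 ⊆ S) (ha : omega4 .a ∈ S)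
    (he : omega4 .e ∈ S) (i : Name4) : Generates S (omega4 i) := by
  have cross := Rel.crossPass_of_mem h2 ha he
  have side (p : Pass) (m : Dir) := Rel.sidePass_of_crossPass h2 (cross p m)
  cases i
  exacts [(side _ _).generates (by simp), (side _ _).generates (by simp),
    (cross _ _).generates (by simp), (cross _ _).generates (by simp),
    (side _ _).generates (by simp), (side _ _).generates (by simp),
    (cross _ _).generates (by simp), (cross _ _).generates (by simp)]

theorem generates_omega5 {S : Set LocalMove} (h1 : omega1 ⊆ S) (h2 : omega2 ⊆ S)
    (ha : omega4 .a ∈ S) (he : omega4 .e ∈ S) {q : Pass} (h5 : twistPass q up up ∈ S)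
    (i : Name5) : Generates S (omega5 i) := by
  have twist (p : Pass) {a b : Dir} (hab : a = up ∨ b = up) : Generates S (twistPass p a b) :=
    (Rel.twistPass_of_mem h1 h2 ha he h5 p hab).generates (by simp)
  cases i
  exacts [twist _ (.inl rfl), twist _ (.inl rfl), twist _ (.inr rfl), twist _ (.inl rfl),
    twist _ (.inl rfl), twist _ (.inr rfl)]

theorem generates_of_mem {S : Set LocalMove} {m : LocalMove} (hm : m ∈ S) : Generates S m := by
  rintro u v D D' ⟨m', rfl, h⟩
  exact .rel _ _ ⟨m', .inr hm, h⟩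

/-- Planar isotopies are available on both sides, so only the steps from `S` have to be replaced. -/
theorem Equivalent.of_generates {S T : Set LocalMove} (h : ∀ m ∈ S, Generates T m) {u v : Word}
    {D D' : Diagram u v} (e : Equivalent S D D') : Equivalent T D D' := by
  induction e with
  | rel D D' e =>
    obtain ⟨m, hm | hm, e⟩ := e
    · exact .rel _ _ ⟨m, .inl hm, e⟩
    · exact h m hm _ _ D D' ⟨m, rfl, e⟩
  | refl => exact .refl _
  | symm _ _ _ ih => exact .symm _ _ ih
  | trans _ _ _ _ _ ih ih' => exact .trans _ _ _ ih ih'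

theorem generates_singularMoves {S : Set LocalMove} (h1 : omega1 ⊆ S) (h2 : omega2 ⊆ S)
    (ha : omega4 .a ∈ S) (he : omega4 .e ∈ S) (h5 : omega5 .a ∈ S) :
    ∀ m ∈ singularMoves, Generates S m := by
  rintro m (⟨i, rfl⟩ | ⟨i, rfl⟩)
  exacts [generates_omega4 h2 ha he i, generates_omega5 h1 h2 ha he h5 i]

end SingularLink

theorem mainTheorem1 :
    (∀ m ∈ singularMoves,
      Generates (omega1 ∪ omega2 ∪ {omega4 .a, omega4 .e, omega5 .a}) m) ∧
    (∀ i : Name4, Generates (omega2 ∪ {omega4 .a, omega4 .e}) (omega4 i)) ∧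
    (∀ i : Name5, Generates (omega1 ∪ omega2 ∪ {omega4 .a, omega4 .e, omega5 .d}) (omega5 i)) ∧
    (∀ D D' : LinkDiagram,
      Equivalent (omega1 ∪ omega2 ∪ omega3 ∪ singularMoves) D D' ↔
        Equivalent (omega1 ∪ omega2 ∪ omega3 ∪ {omega4 .a, omega4 .e, omega5 .a}) D D') := by
  refine ⟨generates_singularMoves (fun m h ↦ by simp [h]) (fun m h ↦ by simp [h]) (by simp)
      (by simp) (by simp),
    generates_omega4 (fun m h ↦ by simp [h]) (by simp) (by simp),
    -- Ω5d is the negative parallel twist; membership holds by `rfl` once `omega5 .d` is unfolded.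
    generates_omega5 (q := .below) (fun m h ↦ by simp [h]) (fun m h ↦ by simp [h]) (by simp)
      (by simp) (.inr (.inr (.inr rfl))),
    fun D D' ↦ ⟨Equivalent.of_generates ?_, Equivalent.of_generates ?_⟩⟩
  · rintro m (hm | hm)
    · exact generates_of_mem (.inl hm)
    · exact generates_singularMoves (fun m h ↦ by simp [h]) (fun m h ↦ by simp [h]) (by simp)
        (by simp) (by simp) m hm
  · rintro m (hm | rfl | rfl | rfl)
    · exact generates_of_mem (.inl hm)
    · exact generates_of_mem (.inr (.inl ⟨.a, rfl⟩))
    · exact generates_of_mem (.inr (.inl ⟨.e, rfl⟩))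
    · exact generates_of_mem (.inr (.inr ⟨.a, rfl⟩))
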